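/- Let $(V,\otimes,k)$ be a commutative quantale with internal hom $[-,-]$ (so $w\otimes u\le v \iff w\le [u,v]$), and write $LX$ for the set of finite lists on a set $X$. An $(L,V)$-category is a set $X$ with a map $a:LX\times X\to V$ such that $k\le a((x),x)$ and $a(\underline x_1,y_1)\otimes\dots\otimes a(\underline x_n,y_n)\otimes a((y_1,\dots,y_n),z)\le a(\underline x_1;\dots;\underline x_n,z)$ (concatenation in the first argument). An $(L,V)$-functor $f:(X,a)\to(Y,b)$ is a map with $a(\underline x,y)\le b(Lf(\underline x),f(y))$; it is fully faithful if equality holds. These form the category $V\text{-}\mathtt{Multi}$. A $V$-prequantum B-algebra is a promonoidal $V$-category $(X,a,P,J)$ (a monoid in $V$-distributors) with binary operations $\rhd,\lhd$ such that $P(-,x,y)=a(-,x\rhd y)$ and $P(x,-,y)=a(-,x\lhd y)$. Its morphisms $f:(X,a,P,J)\to(Y,b,R,U)$ are the $V$-functors with $f(x\rhd y)\le f(x)\rhd f(y)$, $f(x\lhd y)\le f(x)\lhd f(y)$ and $J(x)\le U(f(x))$. This category $V\text{-}\mathtt{PQBalg}$ is regarded as a full subcategory of $V\text{-}\mathtt{Multi}$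 through the $(L,V)$-structure with components $a_0=J$, $a_1=a$, $a_n=P\cdot(\mathrm{Id}\boxtimes a_{n-1})$ for $n\ge 2$. In either category let $\mathcal J$ be the class of arrows that are fully faithful as $(L,V)$-functors. An object $E$ is injective if every arrow $Y\to E$ extends along every $Y\to Z$ in $\mathcal J$; an arrow $e\in\mathcal J$ is essential if $fe\in\mathcal J$ implies $f\in\mathcal J$ for every arrow $f$ defined on the codomain of $e$; an injective hull of $Y$ is an essential arrow $Y\to E$ with $E$ injective. For an $(L,V)$-category $(X,a)$, let $\mathbb D_L(X)$ be the $V$-quantale of $(L,V)$-functors $X^{\mathrm{op}}\boxtimes E\to V$ (where $E$ is the discrete one-point $(L,V)$-category, whose structure is $k$ at the one-element list and $\bot$ at every other list, and $X^{\mathrm{op}}$ is $LX$ with the structure $m_X\cdot (La)^\circ\cdot m_X$, $m_X$ being concatenation), with $(L,V)$-structure $$\mathbb D_L(X)[(f_1,\dots,f_n),g]=\bigwedge_{\underline x_1,\dots,\underline x_n\in LX}[f_1(\underline x_1)\otimes\dots\otimes f_n(\underline x_n),\,g(\underline x_1;\dots;\underline x_n)].$$ Let $X_{\mathbb D_L(X)}$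 be the $V$-prequantum B-algebra generated in $\mathbb D_L(X)$ by the image of the Yoneda embedding $x\mapsto a(-,x)$, i.e. the smallest subset of $\mathbb D_L(X)$ containing this image and closed under the two implications $\rhd,\lhd$ of the quantale (the right adjoints of its multiplication), with the induced structure $P(x,y,z)=\mathbb D_L(X)[(x,y),z]$ and $J(x)=\mathbb D_L(X)[(\,),x]$. **Proposition.** For every $(L,V)$-category $(X,a)$, the algebra $X_{\mathbb D_L(X)}$ has an injective hull in $V\text{-}\mathtt{PQBalg}$; and for every injective hull $X_{\mathbb D_L(X)}\to\tilde X$ in $V\text{-}\mathtt{PQBalg}$, the composite $$(X,a)\to X_{\mathbb D_L(X)}\to\tilde X$$ of the corestricted Yoneda embedding with the hull is (fully faithful and) essential in $V\text{-}\mathtt{Multi}$. -/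

import Mathlib

open CategoryTheory Quantale

universe u

namespace QMulti

/-! Throughout, `V` is a commutative quantale: a complete lattice with a commutative monoid
structure `(*, 1)` whose multiplication preserves suprema in each variable.  The internal hom
`[u, v]` is Mathlib's residuation `u ⇨ₗ v = sSup {w | w * u ≤ v}`. -/

section Relations

variable {V : Type u} [CommMonoid V] [CompleteLattice V]

/-- The extension of the list monad to `V`-relations: `L r (xs, ys)` is
`r x₁ y₁ ⊗ ... ⊗ r xₙ yₙ` if both lists have the same length `n`, and `⊥` otherwise. -/
def listRel {X Y : Type u} (r : X → Y → V) : List X → List Y → V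
  | [], [] => 1
  | x :: xs, y :: ys => r x y * listRel r xs ys
  | [], _ :: _ => ⊥
  | _ :: _, [] => ⊥

/-- The pointwise condition for a function `f` to be an `(L,V)`-functor `(X, a) → (Y, b)`. -/
def IsFunctor {X Y : Type u} (a : List X → X → V) (b : List Y → Y → V) (f : X → Y) : Prop :=
  ∀ xs y, a xs y ≤ b (xs.map f) (f y)

/-- The `(L,V)`-structure of the opposite `X^op`, whose underlying set is `L X`:
`a^op = m_X · (L a)° · m_X`. -/
def opStr {X : Type u} (a : List X → X → V) : List (List X) → List X → V :=
  fun xss ys => ⨆ (zss : List (List X)) (_ : zss.flatten = ys), listRel a zss xss.flatten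

/-- The discrete `(L,V)`-structure `e_X°`; for a one-point set this is the object `E`. -/
noncomputable def discreteStr (X : Type u) : List X → X → V :=
  open Classical in fun xs y => if xs = [y] then 1 else ⊥

/-- The tensor product `a ⊠ b` of two `(L,V)`-structures. -/
def tensorStr {X Y : Type u} (a : List X → X → V) (b : List Y → Y → V) :
    List (X × Y) → X × Y → V :=
  fun γ p => a (γ.map Prod.fst) p.1 * b (γ.map Prod.snd) p.2

/-- The `(L,V)`-structure of `V` itself: `[(v₁, ..., vₙ), w] = [v₁ ⊗ ... ⊗ vₙ, w]`. -/
def selfStr (V : Type u) [CommMonoid V] [CompleteLattice V] : List V → V → V :=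
  fun vs w => vs.prod ⇨ₗ w

end Relations

/-! ### The category of `(L,V)`-categories -/

/-- An `(L,V)`-category: a set with an `(L,V)`-relation `a` such that `e_X° ≤ a` and
`a ∘ a = a · L a · m_X° ≤ a`. -/
structure LVCat (V : Type u) [CommMonoid V] [CompleteLattice V] : Type (u + 1) where
  /-- the underlying set -/
  carrier : Type u
  /-- the structure relation `L X ⇸ X` -/
  str : List carrier → carrier → V
  one_le : ∀ x, 1 ≤ str [x] x
  comp_le : ∀ xss ys z, listRel str xss ys * str ys z ≤ str xss.flatten z

namespace LVCat

variable (V : Type u) [CommMonoid V] [CompleteLattice V]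

/-- `(L,V)`-functors. -/
@[ext]
structure Hom (X Y : LVCat V) : Type u where
  /-- the underlying function -/
  toFun : X.carrier → Y.carrier
  isFunctor : IsFunctor X.str Y.str toFun

instance : Category (LVCat V) where
  Hom X Y := Hom V X Y
  id X := ⟨id, fun xs y => by simp⟩
  comp f g := ⟨g.toFun ∘ f.toFun, fun xs y => by
    have h := g.isFunctor (xs.map f.toFun) (f.toFun y)
    rw [List.map_map] at h
    exact (f.isFunctor xs y).trans h⟩

/-- The class of fully faithful `(L,V)`-functors. -/
def fullyFaithful : MorphismProperty (LVCat V) :=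
  fun X Y f => ∀ xs y, X.str xs y = Y.str (xs.map f.toFun) (f.toFun y)

end LVCat

/-! ### Injective objects, essential arrows, injective hulls in a category -/

section Injectivity

universe v w

variable {C : Type w} [Category.{v} C]

/-- `E` is injective with respect to the class `J` of arrows. -/
def IsInjective (J : MorphismProperty C) (E : C) : Prop :=
  ∀ ⦃Y Z : C⦄ (m : Y ⟶ Z) (g : Y ⟶ E), J m → ∃ h : Z ⟶ E, m ≫ h = g

/-- An arrow `e` is essential with respect to `J`: it lies in `J`, and `e ≫ f ∈ J` implies
`f ∈ J`. -/
def IsEssential (J : MorphismProperty C) {Y E : C} (e : Y ⟶ E) : Prop :=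
  J e ∧ ∀ ⦃Z : C⦄ (f : E ⟶ Z), J (e ≫ f) → J f

/-- The arrow `e : Y ⟶ E` exhibits `E` as an injective hull of `Y` with respect to `J`. -/
def IsInjectiveHull (J : MorphismProperty C) {Y E : C} (e : Y ⟶ E) : Prop :=
  IsInjective J E ∧ IsEssential J e

end Injectivity

/-! ### `V`-prequantum B-algebras -/

/-- A `V`-prequantum B-algebra: a promonoidal `V`-category `(X, a, P, J)` (a monoid in the
monoidal category of `V`-distributors) with binary operations `▷` (`rimp`) and `◁` (`limp`) such
that `P(-, x, y) = a(-, x ▷ y)` and `P(x, -, y) = a(-, x ◁ y)`. -/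
structure PQBAlg (V : Type u) [CommMonoid V] [CompleteLattice V] : Type (u + 1) where
  /-- the underlying set -/
  carrier : Type u
  /-- the `V`-category structure `a` -/
  hom : carrier → carrier → V
  one_le : ∀ x, 1 ≤ hom x x
  hom_comp : ∀ x y z, hom x y * hom y z ≤ hom x z
  /-- the distributor `P : X ⊠ X ⇸ X` -/
  P : carrier → carrier → carrier → V
  P_left : ∀ x x' y y' z, (hom x x' * hom y y') * P x' y' z ≤ P x y z
  P_right : ∀ x y z z', P x y z * hom z z' ≤ P x y z'
  /-- the distributor `J : K ⇸ X` -/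
  J : carrier → V
  J_right : ∀ x y, J x * hom x y ≤ J y
  assoc : ∀ x y z w, ⨆ t, P x y t * P t z w = ⨆ t, P y z t * P x t w
  left_unit : ∀ x w, ⨆ z, J z * P z x w = hom x w
  right_unit : ∀ x w, ⨆ z, J z * P x z w = hom x w
  /-- the operation `▷` -/
  rimp : carrier → carrier → carrier
  /-- the operation `◁` -/
  limp : carrier → carrier → carrier
  P_rimp : ∀ t x y, P t x y = hom t (rimp x y)
  P_limp : ∀ t x y, P x t y = hom t (limp x y)

namespace PQBAlg

variable (V : Type u) [CommMonoid V] [CompleteLattice V]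

/-- Morphisms of `V`-prequantum B-algebras; the order on the underlying set of a `V`-category is
`x ≤ y ↔ 1 ≤ hom x y`. -/
@[ext]
structure Hom (X Y : PQBAlg V) : Type u where
  /-- the underlying function -/
  toFun : X.carrier → Y.carrier
  hom_le : ∀ x y, X.hom x y ≤ Y.hom (toFun x) (toFun y)
  map_rimp : ∀ x y, 1 ≤ Y.hom (toFun (X.rimp x y)) (Y.rimp (toFun x) (toFun y))
  map_limp : ∀ x y, 1 ≤ Y.hom (toFun (X.limp x y)) (Y.limp (toFun x) (toFun y))
  J_le : ∀ x, X.J x ≤ Y.J (toFun x)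

variable {V}

/-- The `(L,V)`-structure of a promonoidal `V`-category: `a₀ = J`, `a₁ = a`, and
`aₙ = P · (Id ⊠ aₙ₋₁)` for `n ≥ 2` (in particular `a₂ = P`). -/
def multiStr (X : PQBAlg V) : List X.carrier → X.carrier → V
  | [], y => X.J y
  | [x], y => X.hom x y
  | x :: x' :: xs, y => ⨆ c, multiStr X (x' :: xs) c * X.P x c y

theorem multiStr_cons (X : PQBAlg V) (x : X.carrier) (xs : List X.carrier) (y : X.carrier) :
    X.multiStr (x :: xs) y = ⨆ c, X.multiStr xs c * X.P x c y := by
  cases xs with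
  | nil => simp only [multiStr]; exact (X.right_unit x y).symm
  | cons x' xs => simp only [multiStr]

variable [IsQuantale V]

theorem Hom.P_le {X Y : PQBAlg V} (f : Hom V X Y) (x y z : X.carrier) :
    X.P x y z ≤ Y.P (f.toFun x) (f.toFun y) (f.toFun z) := by
  rw [X.P_rimp, Y.P_rimp]
  calc X.hom x (X.rimp y z) ≤ Y.hom (f.toFun x) (f.toFun (X.rimp y z)) * 1 := by
        rw [mul_one]; exact f.hom_le _ _
    _ ≤ Y.hom (f.toFun x) (f.toFun (X.rimp y z)) *
        Y.hom (f.toFun (X.rimp y z)) (Y.rimp (f.toFun y) (f.toFun z)) := by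
        gcongr; exact f.map_rimp _ _
    _ ≤ _ := Y.hom_comp _ _ _

theorem one_le_trans (X : PQBAlg V) {x y z : X.carrier} (h : 1 ≤ X.hom x y)
    (h' : 1 ≤ X.hom y z) : 1 ≤ X.hom x z :=
  calc (1 : V) = 1 * 1 := (one_mul 1).symm
    _ ≤ X.hom x y * X.hom y z := by gcongr
    _ ≤ _ := X.hom_comp _ _ _

instance : Category (PQBAlg V) where
  Hom X Y := Hom V X Y
  id X := ⟨id, fun _ _ => le_rfl, fun _ _ => X.one_le _, fun _ _ => X.one_le _, fun _ => le_rfl⟩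
  comp {X Y Z} f g := ⟨g.toFun ∘ f.toFun,
    fun x y => (f.hom_le x y).trans (g.hom_le _ _),
    fun x y => Z.one_le_trans ((f.map_rimp x y).trans (g.hom_le _ _)) (g.map_rimp _ _),
    fun x y => Z.one_le_trans ((f.map_limp x y).trans (g.hom_le _ _)) (g.map_limp _ _),
    fun x => (f.J_le x).trans (g.J_le _)⟩

theorem multiStr_hom (X : PQBAlg V) (xs : List X.carrier) (y z : X.carrier) :
    X.multiStr xs y * X.hom y z ≤ X.multiStr xs z := by
  cases xs with
  | nil => simp only [multiStr]; exact X.J_right y z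
  | cons x xs =>
    rw [multiStr_cons, multiStr_cons, iSup_mul_distrib]
    refine iSup_mono fun c => ?_
    rw [mul_assoc]
    gcongr
    exact X.P_right _ _ _ _

theorem multiStr_append (X : PQBAlg V) (xs us : List X.carrier) (y c z : X.carrier) :
    X.multiStr xs y * (X.multiStr us c * X.P y c z) ≤ X.multiStr (xs ++ us) z := by
  induction xs generalizing y c z with
  | nil =>
    calc X.multiStr [] y * (X.multiStr us c * X.P y c z)
        = X.multiStr us c * (X.J y * X.P y c z) := by
          simp only [multiStr]; rw [mul_left_comm]
      _ ≤ X.multiStr us c * X.hom c z := by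
          gcongr
          rw [← X.left_unit c z]
          exact le_iSup (fun t => X.J t * X.P t c z) y
      _ ≤ _ := X.multiStr_hom us c z
  | cons x xs ih =>
    rw [List.cons_append, multiStr_cons, multiStr_cons, iSup_mul_distrib]
    refine iSup_le fun d => ?_
    calc X.multiStr xs d * X.P x d y * (X.multiStr us c * X.P y c z)
        = (X.multiStr xs d * X.multiStr us c) * (X.P x d y * X.P y c z) := by
          rw [mul_mul_mul_comm]
      _ ≤ (X.multiStr xs d * X.multiStr us c) * ⨆ t, X.P d c t * X.P x t z := by
          gcongr
          rw [← X.assoc]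
          exact le_iSup (fun t => X.P x d t * X.P t c z) y
      _ = ⨆ t, X.multiStr xs d * (X.multiStr us c * X.P d c t) * X.P x t z := by
          rw [mul_iSup_distrib]; simp only [mul_assoc]
      _ ≤ _ := iSup_mono fun t => by gcongr; exact ih d c t

/-- The `(L,V)`-category of a `V`-prequantum B-algebra. -/
def toLVCat (X : PQBAlg V) : LVCat V where
  carrier := X.carrier
  str := X.multiStr
  one_le x := by simp only [multiStr]; exact X.one_le x
  comp_le xss := by
    induction xss with
    | nil =>
      intro ys z
      cases ys with
      | nil => simp [listRel]
      | cons y ys => simp [listRel]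
    | cons xs xss ih =>
      intro ys z
      cases ys with
      | nil => simp [listRel]
      | cons y ys =>
        simp only [listRel, List.flatten_cons]
        rw [multiStr_cons, mul_iSup_distrib]
        refine iSup_le fun c => ?_
        calc X.multiStr xs y * listRel X.multiStr xss ys * (X.multiStr ys c * X.P y c z)
            = X.multiStr xs y * ((listRel X.multiStr xss ys * X.multiStr ys c) * X.P y c z) := by
              simp only [mul_assoc]
          _ ≤ X.multiStr xs y * (X.multiStr xss.flatten c * X.P y c z) := by
              gcongr; exact ih ys c
          _ ≤ _ := X.multiStr_append _ _ _ _ _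

theorem Hom.isFunctor {X Y : PQBAlg V} (f : Hom V X Y) :
    IsFunctor X.multiStr Y.multiStr f.toFun := by
  intro xs
  induction xs with
  | nil => intro y; simp only [multiStr, List.map_nil]; exact f.J_le y
  | cons x xs ih =>
    intro y
    rw [List.map_cons, multiStr_cons, multiStr_cons]
    refine iSup_le fun c => le_trans ?_ (le_iSup _ (f.toFun c))
    gcongr
    · exact ih c
    · exact f.P_le _ _ _

variable (V) in
/-- The inclusion of `V`-prequantum B-algebras into `(L,V)`-categories. -/
def toMulti : PQBAlg V ⥤ LVCat V where
  obj X := X.toLVCat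
  map f := ⟨f.toFun, Hom.isFunctor f⟩

variable (V) in
/-- The morphisms of `V`-prequantum B-algebras that are fully faithful as `(L,V)`-functors. -/
def fullyFaithful : MorphismProperty (PQBAlg V) :=
  (LVCat.fullyFaithful V).inverseImage (toMulti V)

end PQBAlg

/-! ### `V`-quantales -/

/-- A `V`-quantale: a separated cocomplete `V`-category with a monoid structure whose
multiplication is a `V`-functor that is cocontinuous in each variable.  Cocompleteness says that
every weighted diagram has a colimit; for a cocomplete `V`-category, cocontinuity of `- * y` and
`x * -` amounts to the existence of the right adjoints `y ▷ -` (`rimp`) and `x ◁ -` (`limp`). -/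
structure VQuantale (V : Type u) [CommMonoid V] [CompleteLattice V] : Type (u + 1) where
  /-- the underlying set -/
  carrier : Type u
  /-- the `V`-category structure -/
  hom : carrier → carrier → V
  one_le : ∀ x, 1 ≤ hom x x
  hom_comp : ∀ x y z, hom x y * hom y z ≤ hom x z
  separated : ∀ x y, 1 ≤ hom x y → 1 ≤ hom y x → x = y
  cocomplete : ∀ {I : Type u} (w : I → V) (f : I → carrier),
    ∃ s, ∀ y, hom s y = ⨅ i, (w i ⇨ₗ hom (f i) y)
  /-- the multiplication -/
  mul : carrier → carrier → carrier
  /-- the unit -/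
  unit : carrier
  mul_assoc : ∀ x y z, mul (mul x y) z = mul x (mul y z)
  unit_mul : ∀ x, mul unit x = x
  mul_unit : ∀ x, mul x unit = x
  mul_functor : ∀ x x' y y', hom x x' * hom y y' ≤ hom (mul x y) (mul x' y')
  /-- the right implication -/
  rimp : carrier → carrier → carrier
  /-- the left implication -/
  limp : carrier → carrier → carrier
  rimp_adj : ∀ x y z, hom (mul x y) z = hom x (rimp y z)
  limp_adj : ∀ x y z, hom (mul x y) z = hom y (limp x z)

namespace VQuantale

variable {V : Type u} [CommMonoid V] [CompleteLattice V]

/-- The product `q₁ * ... * qₙ` of a list. -/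
def prod (Q : VQuantale V) (qs : List Q.carrier) : Q.carrier := qs.foldr Q.mul Q.unit

/-- The elements obtained from `S` by successively adding implications; equivalently, the
smallest subset of `Q` that contains `S` and is closed under `▷` and `◁`. -/
inductive Generated (Q : VQuantale V) (S : Set Q.carrier) : Q.carrier → Prop
  | base (x : Q.carrier) : x ∈ S → Generated Q S x
  | rimp (x y : Q.carrier) : Generated Q S x → Generated Q S y → Generated Q S (Q.rimp x y)
  | limp (x y : Q.carrier) : Generated Q S x → Generated Q S y → Generated Q S (Q.limp x y)

variable [IsQuantale V]

theorem iSup_hom_hom (Q : VQuantale V) (p : Q.carrier → Prop) (x z : Q.carrier) (hz : p z) :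
    ⨆ t : {t // p t}, Q.hom x t.1 * Q.hom t.1 z = Q.hom x z := by
  apply le_antisymm
  · exact iSup_le fun t => Q.hom_comp _ _ _
  · refine le_trans ?_ (le_iSup _ ⟨z, hz⟩)
    calc Q.hom x z = Q.hom x z * 1 := (mul_one _).symm
      _ ≤ _ := by gcongr; exact Q.one_le z

theorem mul_functor_left (Q : VQuantale V) (x x' y : Q.carrier) :
    Q.hom x x' ≤ Q.hom (Q.mul x y) (Q.mul x' y) :=
  calc Q.hom x x' = Q.hom x x' * 1 := (mul_one _).symm
    _ ≤ Q.hom x x' * Q.hom y y := by gcongr; exact Q.one_le y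
    _ ≤ _ := Q.mul_functor _ _ _ _

/-- The `V`-prequantum B-algebra generated by a subset `S` of a `V`-quantale `Q`: the closure of
`S` under both implications, with the `V`-structure induced by `Q`, with
`P(x, y, z) = Q(x * y, z)` and with `J(x) = Q(u_Q, x)`. -/
def generatedPQBAlg (Q : VQuantale V) (S : Set Q.carrier) : PQBAlg V where
  carrier := {x // Generated Q S x}
  hom x y := Q.hom x.1 y.1
  one_le x := Q.one_le _
  hom_comp x y z := Q.hom_comp _ _ _
  P x y z := Q.hom (Q.mul x.1 y.1) z.1
  P_left x x' y y' z := by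
    refine le_trans ?_ (Q.hom_comp _ (Q.mul x'.1 y'.1) _)
    gcongr
    exact Q.mul_functor _ _ _ _
  P_right x y z z' := Q.hom_comp _ _ _
  J x := Q.hom Q.unit x.1
  J_right x y := Q.hom_comp _ _ _
  assoc x y z w := by
    have h1 := Q.iSup_hom_hom (Generated Q S) (Q.mul x.1 y.1) (Q.rimp z.1 w.1)
      (.rimp _ _ z.2 w.2)
    have h2 := Q.iSup_hom_hom (Generated Q S) (Q.mul y.1 z.1) (Q.limp x.1 w.1)
      (.limp _ _ x.2 w.2)
    simp only [← Q.rimp_adj] at h1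
    simp only [← Q.limp_adj] at h2
    rw [h1, h2, Q.mul_assoc]
  left_unit x w := by
    have h := Q.iSup_hom_hom (Generated Q S) Q.unit (Q.rimp x.1 w.1) (.rimp _ _ x.2 w.2)
    simp only [← Q.rimp_adj] at h
    rw [h, Q.unit_mul]
  right_unit x w := by
    have h := Q.iSup_hom_hom (Generated Q S) Q.unit (Q.limp x.1 w.1) (.limp _ _ x.2 w.2)
    simp only [← Q.limp_adj] at h
    rw [h, Q.mul_unit]
  rimp x y := ⟨Q.rimp x.1 y.1, .rimp _ _ x.2 y.2⟩
  limp x y := ⟨Q.limp x.1 y.1, .limp _ _ x.2 y.2⟩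
  P_rimp t x y := Q.rimp_adj _ _ _
  P_limp t x y := Q.limp_adj _ _ _

/-- The `(L,V)`-structure of the generated algebra is the one induced by
`Q((q₁, ..., qₙ), w) = Q(q₁ * ... * qₙ, w)`. -/
theorem generatedPQBAlg_multiStr (Q : VQuantale V) (S : Set Q.carrier)
    (xs : List (Q.generatedPQBAlg S).carrier) (y : (Q.generatedPQBAlg S).carrier) :
    (Q.generatedPQBAlg S).multiStr xs y = Q.hom (Q.prod (xs.map Subtype.val)) y.1 := by
  induction xs generalizing y with
  | nil => rfl
  | cons x xs ih =>
    rw [PQBAlg.multiStr_cons]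
    simp only [ih]
    have h := Q.iSup_hom_hom (Generated Q S) (Q.prod (xs.map Subtype.val)) (Q.limp x.1 y.1)
      (.limp _ _ x.2 y.2)
    simp only [← Q.limp_adj] at h
    exact h

end VQuantale

/-! ### The presheaf `V`-quantale of an `(L,V)`-category -/

namespace LVCat

variable {V : Type u} [CommMonoid V] [CompleteLattice V]

/-- A presheaf on `X`: an `(L,V)`-functor `X^op ⊠ E → V`; its underlying function
`L X × 1 → V` is written as a function `L X → V`. -/
def IsPresheaf (X : LVCat V) (φ : List X.carrier → V) : Prop :=
  IsFunctor (tensorStr (opStr X.str) (discreteStr PUnit.{u + 1})) (selfStr V) (fun p => φ p.1)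

/-- The underlying set of `D_L(X)`. -/
def Presheaf (X : LVCat V) : Type u := {φ : List X.carrier → V // X.IsPresheaf φ}

/-- The `(L,V)`-structure of `D_L(X)`: the infimum over all `(x₁, ..., xₙ)`, lists of lists of
the same length as `fs = (f₁, ..., fₙ)`, of `[f₁ x₁ ⊗ ... ⊗ fₙ xₙ, g (m_X (x₁, ..., xₙ))]`. -/
def presheafStr (X : LVCat V) (fs : List X.Presheaf) (g : X.Presheaf) : V :=
  ⨅ (xss : List (List X.carrier)) (_ : xss.length = fs.length),
    ((List.zipWith (fun f xs => f.1 xs) fs xss).prod ⇨ₗ g.1 xss.flatten)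

variable [IsQuantale V]

theorem isPresheaf_iff (X : LVCat V) (φ : List X.carrier → V) :
    X.IsPresheaf φ ↔ ∀ zss ws, listRel X.str zss ws * φ ws ≤ φ zss.flatten := by
  constructor
  · intro h zss ws
    have := h [(ws, PUnit.unit)] (zss.flatten, PUnit.unit)
    simp only [tensorStr, discreteStr, selfStr, List.map_cons, List.map_nil, if_true, mul_one,
      List.prod_cons, List.prod_nil] at this
    rw [leftMulResiduation_le_iff_mul_le] at this
    refine le_trans ?_ this
    gcongr
    refine le_trans ?_ (le_iSup₂ (f := fun zss' (_ : zss'.flatten = zss.flatten) =>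
      listRel X.str zss' [ws].flatten) zss rfl)
    simp
  · rintro h γ ⟨ys, t⟩
    simp only [tensorStr, discreteStr, selfStr]
    split_ifs with ht
    · match γ, ht with
      | [(ws, s)], _ =>
        simp only [opStr, List.map_cons, List.map_nil, List.prod_cons, List.prod_nil, mul_one]
        refine iSup₂_le fun zss hz => ?_
        rw [leftMulResiduation_le_iff_mul_le]
        subst hz
        simpa using h zss ws
    · simp

theorem listRel_append_right {X Y : Type u} (r : X → Y → V) (zs : List X) (xs ys : List Y) :
    listRel r zs (xs ++ ys) =
      listRel r (zs.take xs.length) xs * listRel r (zs.drop xs.length) ys := by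
  induction xs generalizing zs with
  | nil => simp [listRel]
  | cons x xs ih =>
    cases zs with
    | nil => simp [listRel]
    | cons z zs => simp [listRel, ih, mul_assoc]

theorem listRel_append {X Y : Type u} (r : X → Y → V) (zs ws : List X) (xs ys : List Y) :
    listRel r zs xs * listRel r ws ys ≤ listRel r (zs ++ ws) (xs ++ ys) := by
  induction zs generalizing xs with
  | nil =>
    cases xs with
    | nil => simp [listRel]
    | cons x xs => simp [listRel]
  | cons z zs ih =>
    cases xs with
    | nil => simp [listRel]
    | cons x xs =>
      simp only [listRel, List.cons_append]
      rw [mul_assoc]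
      gcongr
      exact ih xs

theorem one_le_listRel_singletons (X : LVCat V) (xs : List X.carrier) :
    1 ≤ listRel X.str (xs.map fun x => [x]) xs := by
  induction xs with
  | nil => simp [listRel]
  | cons x xs ih =>
    simp only [listRel, List.map_cons]
    calc (1 : V) = 1 * 1 := (one_mul 1).symm
      _ ≤ _ := by gcongr; exact X.one_le x

theorem flatten_singletons {X : Type u} (xs : List X) : (xs.map fun x => [x]).flatten = xs := by
  induction xs with
  | nil => rfl
  | cons x xs ih => simp [ih]

namespace Presheaf

variable {X : LVCat V}

theorem act (φ : X.Presheaf) (zss : List (List X.carrier)) (ws : List X.carrier) :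
    listRel X.str zss ws * φ.1 ws ≤ φ.1 zss.flatten :=
  (X.isPresheaf_iff φ.1).1 φ.2 zss ws

theorem act_left (φ : X.Presheaf) (zss : List (List X.carrier)) (ws ys : List X.carrier) :
    listRel X.str zss ws * φ.1 (ws ++ ys) ≤ φ.1 (zss.flatten ++ ys) := by
  have h := φ.act (zss ++ ys.map fun x => [x]) (ws ++ ys)
  rw [List.flatten_append, flatten_singletons] at h
  refine le_trans ?_ h
  gcongr
  refine le_trans ?_ (listRel_append _ _ _ _ _)
  calc listRel X.str zss ws = listRel X.str zss ws * 1 := (mul_one _).symm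
    _ ≤ _ := by gcongr; exact one_le_listRel_singletons X ys

theorem act_right (φ : X.Presheaf) (zss : List (List X.carrier)) (ws ys : List X.carrier) :
    listRel X.str zss ws * φ.1 (ys ++ ws) ≤ φ.1 (ys ++ zss.flatten) := by
  have h := φ.act ((ys.map fun x => [x]) ++ zss) (ys ++ ws)
  rw [List.flatten_append, flatten_singletons] at h
  refine le_trans ?_ h
  gcongr
  refine le_trans ?_ (listRel_append _ _ _ _ _)
  calc listRel X.str zss ws = 1 * listRel X.str zss ws := (one_mul _).symm
    _ ≤ _ := by gcongr; exact one_le_listRel_singletons X ys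

/-- The convolution product of presheaves:
`(φ * ψ)(zs) = ⋁ φ xs ⊗ ψ ys`, over all `xs`, `ys` with `(xs; ys) = zs`. -/
def mul (φ ψ : X.Presheaf) : X.Presheaf :=
  ⟨fun zs => ⨆ p : {p : List X.carrier × List X.carrier // p.1 ++ p.2 = zs},
      φ.1 p.1.1 * ψ.1 p.1.2,
   (X.isPresheaf_iff _).2 fun zss ws => by
    rw [mul_iSup_distrib]
    refine iSup_le ?_
    rintro ⟨⟨xs, ys⟩, rfl⟩
    refine le_trans ?_ (le_iSup _ ⟨((zss.take xs.length).flatten, (zss.drop xs.length).flatten),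
      by rw [← List.flatten_append, List.take_append_drop]⟩)
    rw [listRel_append_right, mul_mul_mul_comm]
    gcongr
    · exact φ.act _ _
    · exact ψ.act _ _⟩

theorem le_mul (φ ψ : X.Presheaf) (xs ys : List X.carrier) :
    φ.1 xs * ψ.1 ys ≤ (mul φ ψ).1 (xs ++ ys) :=
  le_iSup (fun p : {p : List X.carrier × List X.carrier // p.1 ++ p.2 = xs ++ ys} =>
    φ.1 p.1.1 * ψ.1 p.1.2) ⟨(xs, ys), rfl⟩

theorem mul_mul_le_iff (φ ψ : X.Presheaf) (v : V) (t : List X.carrier → V) :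
    (∀ zs, v * (mul φ ψ).1 zs ≤ t zs) ↔ ∀ xs ys, v * (φ.1 xs * ψ.1 ys) ≤ t (xs ++ ys) := by
  constructor
  · intro h xs ys
    refine le_trans ?_ (h _)
    gcongr
    exact le_mul _ _ _ _
  · intro h zs
    simp only [mul, mul_iSup_distrib]
    refine iSup_le ?_
    rintro ⟨⟨xs, ys⟩, rfl⟩
    exact h xs ys

theorem mul_le_iff (φ ψ : X.Presheaf) (t : List X.carrier → V) :
    (∀ zs, (mul φ ψ).1 zs ≤ t zs) ↔ ∀ xs ys, φ.1 xs * ψ.1 ys ≤ t (xs ++ ys) := by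
  simpa using mul_mul_le_iff φ ψ 1 t

/-- The unit presheaf, represented by the empty list. -/
noncomputable def unit : X.Presheaf :=
  ⟨open Classical in fun zs => if zs = [] then 1 else ⊥,
   (X.isPresheaf_iff _).2 fun zss ws => by
    cases ws with
    | nil =>
      cases zss with
      | nil => simp [listRel]
      | cons z zss => simp [listRel]
    | cons w ws => simp⟩

/-- `(ψ ▷ χ)(xs) = ⋀ ys, [ψ ys, χ (xs; ys)]`. -/
def rimp (ψ χ : X.Presheaf) : X.Presheaf :=
  ⟨fun xs => ⨅ ys, (ψ.1 ys ⇨ₗ χ.1 (xs ++ ys)),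
   (X.isPresheaf_iff _).2 fun zss ws => by
    refine le_iInf fun ys => ?_
    rw [leftMulResiduation_le_iff_mul_le]
    refine le_trans ?_ (χ.act_left zss ws ys)
    rw [mul_assoc]
    gcongr
    rw [← leftMulResiduation_le_iff_mul_le]
    exact iInf_le _ ys⟩

/-- `(φ ◁ χ)(ys) = ⋀ xs, [φ xs, χ (xs; ys)]`. -/
def limp (φ χ : X.Presheaf) : X.Presheaf :=
  ⟨fun ys => ⨅ xs, (φ.1 xs ⇨ₗ χ.1 (xs ++ ys)),
   (X.isPresheaf_iff _).2 fun zss ws => by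
    refine le_iInf fun ys => ?_
    rw [leftMulResiduation_le_iff_mul_le]
    refine le_trans ?_ (χ.act_right zss ws ys)
    rw [mul_assoc]
    gcongr
    rw [← leftMulResiduation_le_iff_mul_le]
    exact iInf_le _ ys⟩

theorem le_str_singleton (v : V) (f g : X.Presheaf) :
    v ≤ X.presheafStr [f] g ↔ ∀ xs, v * f.1 xs ≤ g.1 xs := by
  simp only [presheafStr, le_iInf_iff, leftMulResiduation_le_iff_mul_le]
  constructor
  · intro h xs
    simpa using h [xs] rfl
  · intro h xss hx
    match xss, hx with
    | [xs], _ => simpa using h xs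

theorem le_str_mul (v : V) (φ ψ χ : X.Presheaf) :
    v ≤ X.presheafStr [mul φ ψ] χ ↔ ∀ xs ys, v * (φ.1 xs * ψ.1 ys) ≤ χ.1 (xs ++ ys) := by
  rw [le_str_singleton, mul_mul_le_iff]

theorem str_mul_rimp (φ ψ χ : X.Presheaf) :
    X.presheafStr [mul φ ψ] χ = X.presheafStr [φ] (rimp ψ χ) := by
  refine eq_of_forall_le_iff fun v => ?_
  rw [le_str_mul, le_str_singleton]
  simp only [rimp, le_iInf_iff, leftMulResiduation_le_iff_mul_le, mul_assoc]

theorem str_mul_limp (φ ψ χ : X.Presheaf) :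
    X.presheafStr [mul φ ψ] χ = X.presheafStr [ψ] (limp φ χ) := by
  refine eq_of_forall_le_iff fun v => ?_
  rw [le_str_mul, le_str_singleton, forall_comm]
  simp only [limp, le_iInf_iff, leftMulResiduation_le_iff_mul_le, mul_assoc]
  simp only [mul_comm]

theorem one_le_str (f : X.Presheaf) : 1 ≤ X.presheafStr [f] f := by
  rw [le_str_singleton]; simp

theorem str_comp (f g h : X.Presheaf) :
    X.presheafStr [f] g * X.presheafStr [g] h ≤ X.presheafStr [f] h := by
  rw [le_str_singleton]
  intro xs
  have h1 := (le_str_singleton _ f g).1 le_rfl xs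
  have h2 := (le_str_singleton _ g h).1 le_rfl xs
  calc X.presheafStr [f] g * X.presheafStr [g] h * f.1 xs
      = X.presheafStr [g] h * (X.presheafStr [f] g * f.1 xs) := by
        rw [mul_comm (X.presheafStr [f] g), mul_assoc]
    _ ≤ X.presheafStr [g] h * g.1 xs := by gcongr
    _ ≤ _ := h2

theorem str_separated (f g : X.Presheaf) (h : 1 ≤ X.presheafStr [f] g)
    (h' : 1 ≤ X.presheafStr [g] f) : f = g := by
  rw [le_str_singleton] at h h'
  simp only [one_mul] at h h'
  exact Subtype.ext (funext fun xs => le_antisymm (h xs) (h' xs))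

theorem str_mul_functor (f f' g g' : X.Presheaf) :
    X.presheafStr [f] f' * X.presheafStr [g] g' ≤ X.presheafStr [mul f g] (mul f' g') := by
  rw [le_str_mul]
  intro xs ys
  rw [mul_mul_mul_comm]
  refine le_trans ?_ (le_mul _ _ _ _)
  gcongr
  · exact (le_str_singleton _ f f').1 le_rfl xs
  · exact (le_str_singleton _ g g').1 le_rfl ys

theorem unit_mul (f : X.Presheaf) : mul unit f = f := by
  refine Subtype.ext (funext fun zs => le_antisymm ?_ ?_)
  · revert zs
    rw [mul_le_iff]
    intro xs ys
    cases xs with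
    | nil => simp [unit]
    | cons x xs => simp [unit]
  · exact le_trans (by simp [unit]) (le_mul unit f [] zs)

theorem mul_unit (f : X.Presheaf) : mul f unit = f := by
  refine Subtype.ext (funext fun zs => le_antisymm ?_ ?_)
  · revert zs
    rw [mul_le_iff]
    intro xs ys
    cases ys with
    | nil => simp [unit]
    | cons x xs => simp [unit]
  · have h := le_mul f unit zs []
    rw [List.append_nil] at h
    exact le_trans (by simp [unit]) h

theorem mul_assoc' (f g h : X.Presheaf) : mul (mul f g) h = mul f (mul g h) := by
  refine Subtype.ext (funext fun zs => le_antisymm ?_ ?_)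
  · revert zs
    rw [mul_le_iff]
    intro xs ys
    rw [mul_comm]
    revert xs
    rw [mul_mul_le_iff f g (h.1 ys) fun xs => (mul f (mul g h)).1 (xs ++ ys)]
    intro us vs
    rw [mul_comm, mul_assoc, List.append_assoc]
    refine le_trans ?_ (le_mul _ _ _ _)
    gcongr
    exact le_mul _ _ _ _
  · revert zs
    rw [mul_le_iff]
    intro xs
    rw [mul_mul_le_iff g h (f.1 xs) fun ys => (mul (mul f g) h).1 (xs ++ ys)]
    intro us vs
    rw [← mul_assoc, ← List.append_assoc]
    refine le_trans ?_ (le_mul _ _ _ _)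
    gcongr
    exact le_mul _ _ _ _

/-- The colimit of a weighted diagram of presheaves. -/
def colim {I : Type u} (w : I → V) (f : I → X.Presheaf) : X.Presheaf :=
  ⟨fun xs => ⨆ i, w i * (f i).1 xs,
   (X.isPresheaf_iff _).2 fun zss ws => by
    rw [mul_iSup_distrib]
    refine iSup_mono fun i => ?_
    rw [mul_left_comm]
    gcongr
    exact (f i).act _ _⟩

theorem str_colim {I : Type u} (w : I → V) (f : I → X.Presheaf) (g : X.Presheaf) :
    X.presheafStr [colim w f] g = ⨅ i, (w i ⇨ₗ X.presheafStr [f i] g) := by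
  refine eq_of_forall_le_iff fun v => ?_
  rw [le_str_singleton]
  simp only [le_iInf_iff, leftMulResiduation_le_iff_mul_le, le_str_singleton, colim,
    mul_iSup_distrib, iSup_le_iff, mul_assoc]
  exact forall_comm

end Presheaf

/-- The `V`-quantale `D_L(X)`; its `V`-structure is the unary part of the `(L,V)`-structure. -/
noncomputable def presheafQuantale (X : LVCat V) : VQuantale V where
  carrier := X.Presheaf
  hom f g := X.presheafStr [f] g
  one_le := Presheaf.one_le_str
  hom_comp := Presheaf.str_comp
  separated := Presheaf.str_separated
  cocomplete w f := ⟨Presheaf.colim w f, Presheaf.str_colim w f⟩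
  mul := Presheaf.mul
  unit := Presheaf.unit
  mul_assoc := Presheaf.mul_assoc'
  unit_mul := Presheaf.unit_mul
  mul_unit := Presheaf.mul_unit
  mul_functor := Presheaf.str_mul_functor
  rimp := Presheaf.rimp
  limp := Presheaf.limp
  rimp_adj := Presheaf.str_mul_rimp
  limp_adj := Presheaf.str_mul_limp

/-- The `(L,V)`-structure of `D_L(X)` is represented by the product of the `V`-quantale. -/
theorem presheafStr_eq (X : LVCat V) (fs : List X.Presheaf) (g : X.Presheaf) :
    X.presheafStr fs g = X.presheafQuantale.hom (X.presheafQuantale.prod fs) g := by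
  induction fs generalizing g with
  | nil =>
    refine eq_of_forall_le_iff fun v => ?_
    change _ ↔ v ≤ X.presheafStr [Presheaf.unit] g
    rw [Presheaf.le_str_singleton]
    simp only [presheafStr, le_iInf_iff, leftMulResiduation_le_iff_mul_le]
    constructor
    · intro h xs
      cases xs with
      | nil => simpa [Presheaf.unit] using h [] rfl
      | cons x xs => simp [Presheaf.unit]
    · intro h xss hx
      match xss, hx with
      | [], _ => simpa [Presheaf.unit] using h []
  | cons f fs ih =>
    have h1 := X.presheafQuantale.limp_adj f (X.presheafQuantale.prod fs) g
    refine Eq.trans ?_ ((ih _).trans h1.symm)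
    refine eq_of_forall_le_iff fun v => ?_
    change v ≤ X.presheafStr (f :: fs) g ↔ v ≤ X.presheafStr fs (Presheaf.limp f g)
    simp only [presheafStr, le_iInf_iff, leftMulResiduation_le_iff_mul_le, Presheaf.limp]
    constructor
    · intro h xss hx xs
      have := h (xs :: xss) (by simp [hx])
      simp only [List.zipWith_cons_cons, List.prod_cons, List.flatten_cons] at this
      rwa [mul_assoc, mul_comm _ (f.1 xs)]
    · intro h xss hx
      match xss, hx with
      | xs :: xss, hx =>
        have := h xss (by simpa using hx) xs
        simp only [List.zipWith_cons_cons, List.prod_cons, List.flatten_cons]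
        rwa [mul_assoc, mul_comm _ (f.1 xs)] at this

/-- The Yoneda embedding `x ↦ a(-, x)`. -/
def yoneda (X : LVCat V) (x : X.carrier) : X.Presheaf :=
  ⟨fun ys => X.str ys x, (X.isPresheaf_iff _).2 fun zss ws => X.comp_le zss ws x⟩

theorem le_presheafStr_yoneda (X : LVCat V) (xs : List X.carrier) (x : X.carrier) :
    X.str xs x ≤ X.presheafStr (xs.map X.yoneda) (X.yoneda x) := by
  simp only [presheafStr, le_iInf_iff, leftMulResiduation_le_iff_mul_le]
  intro xss hx
  refine le_trans ?_ (X.comp_le xss xs x)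
  rw [mul_comm]
  gcongr
  clear x
  induction xs generalizing xss with
  | nil =>
    match xss, hx with
    | [], _ => simp [listRel]
  | cons y xs ih =>
    match xss, hx with
    | ys :: xss, hx =>
      simp only [List.map_cons, List.zipWith_cons_cons, List.prod_cons, listRel]
      gcongr
      · exact le_rfl
      · exact ih xss (by simpa using hx)

/-- The `V`-prequantum B-algebra `X_{D_L(X)}` generated by the Yoneda image in `D_L(X)`. -/
noncomputable def generatedAlg (X : LVCat V) : PQBAlg V :=
  X.presheafQuantale.generatedPQBAlg (Set.range X.yoneda)

/-- The corestriction `X → X_{D_L(X)}` of the Yoneda embedding. -/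
noncomputable def toGeneratedAlg (X : LVCat V) :
    X ⟶ (PQBAlg.toMulti V).obj X.generatedAlg :=
  LVCat.Hom.mk (fun x => ⟨X.yoneda x, .base _ ⟨x, rfl⟩⟩) fun xs x => by
    refine (X.le_presheafStr_yoneda xs x).trans (le_of_eq ?_)
    refine (X.presheafStr_eq _ _).trans ?_
    refine Eq.trans ?_ (X.presheafQuantale.generatedPQBAlg_multiStr _ _ _).symm
    refine congrArg (fun qs => X.presheafQuantale.hom (X.presheafQuantale.prod qs) (X.yoneda x)) ?_
    induction xs with
    | nil => rfl
    | cons y xs ih => exact congrArg (List.cons (X.yoneda y)) ih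

end LVCat

end QMulti

/-!
Write `Q` for the presheaf quantale `D_L(X)` and `Y ⊆ Q` for the algebra generated by the
representables.  The hull of `Y` is a MacNeille completion formed inside `Q`: the algebra `E`
generated by all weighted limits in `Q` of elements of `Y` (`hullAlg`).

*Reflection.*  Every presheaf `φ` has a best approximation
`reflect φ = ⋀ z ∈ Y, [Q(φ, z), z]` in `E`.  As `Y` is closed under implications by
representables, `z ∈ Y` implies that `xs ↦ z (us; xs; vs)` is in `Y` (`exists_translate`);
therefore `φ` may be replaced by `reflect φ` in any inequality `v * φ xs ≤ χ (us; xs; vs)` with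
`χ ∈ E` (`reflect_le`).  Thus `reflect` behaves like a quantic nucleus.

*Injectivity.*  An arrow `g : A ⟶ E` extends along a fully faithful `m : A ⟶ B` by sending `b` to
the reflection of the colimit `⋁ as, B(m as, b) ⊗ g a₁ * ... * g aₙ` (`hullAlg_isInjective`).

*Essentiality.*  Let `f : E → Z` be any `(L,V)`-functor whose restriction to `X` is fully
faithful.  Then `Z(f ψs, f χ) ≤ E(ψs, χ)` holds for representable `χ` because the `ψs` are colimits
of products of representables, and it is inherited by weighted limits and by both implications
(`str_map_le`).  So `X → E` is essential already in `V`-`Multi`, and this yields essentiality of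
`Y ⟶ E` among prequantum B-algebras.

*Other hulls.*  An arbitrary injective hull `E'` of `Y` is a retract of `E` compatibly with the
arrows from `Y`, by a fully faithful section `E' ⟶ E`, and essentiality passes to it.
-/

namespace QMulti

variable {V : Type u} [CommMonoid V] [CompleteLattice V]

/-! ### Formal properties of fully faithful arrows -/

theorem LVCat.fullyFaithful_comp {X Y Z : LVCat V} (f : X ⟶ Y) (g : Y ⟶ Z)
    (hf : LVCat.fullyFaithful V f) (hg : LVCat.fullyFaithful V g) :
    LVCat.fullyFaithful V (f ≫ g) := by
  intro xs y
  have h := hg (xs.map f.toFun) (f.toFun y)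
  rw [List.map_map] at h
  exact (hf xs y).trans h

variable [IsQuantale V]

theorem PQBAlg.one_le_multiStr_rimp (A : PQBAlg V) (x y : A.carrier) :
    1 ≤ A.multiStr [A.rimp x y, x] y := by
  simp only [PQBAlg.multiStr]
  refine le_trans ?_ (le_iSup _ x)
  rw [A.P_rimp]
  exact one_le_mul (A.one_le _) (A.one_le _)

theorem PQBAlg.one_le_multiStr_limp (A : PQBAlg V) (x y : A.carrier) :
    1 ≤ A.multiStr [x, A.limp x y] y := by
  simp only [PQBAlg.multiStr]
  refine le_trans ?_ (le_iSup _ (A.limp x y))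
  rw [A.P_limp]
  exact one_le_mul (A.one_le _) (A.one_le _)

namespace LVCat

variable {X : LVCat V}

/-! ### Presheaves, representables and weighted limits -/

theorem prod_zipWith_yoneda_le (xs : List X.carrier) (xss : List (List X.carrier))
    (h : xss.length = xs.length) :
    (List.zipWith (fun (f : X.Presheaf) ys => f.1 ys) (xs.map X.yoneda) xss).prod ≤
      listRel X.str xss xs := by
  induction xs generalizing xss with
  | nil =>
    match xss, h with
    | [], _ => simp [listRel]
  | cons y xs ih =>
    match xss, h with
    | ys :: xss, h =>
      simp only [List.map_cons, List.zipWith_cons_cons, List.prod_cons, listRel]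
      gcongr
      · exact le_rfl
      · exact ih xss (by simpa using h)

/-- The Yoneda lemma for lists of representables. -/
theorem presheafStr_map_yoneda (xs : List X.carrier) (φ : X.Presheaf) :
    X.presheafStr (xs.map X.yoneda) φ = φ.1 xs := by
  apply le_antisymm
  · refine le_trans (iInf₂_le (xs.map fun x => [x]) (by simp)) ?_
    rw [flatten_singletons]
    have h : 1 ≤ (List.zipWith (fun (f : X.Presheaf) ys => f.1 ys) (xs.map X.yoneda)
        (xs.map fun x => [x])).prod := by
      induction xs with
      | nil => simp
      | cons x xs ih =>
        simp only [List.map_cons, List.zipWith_cons_cons, List.prod_cons]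
        exact one_le_mul (X.one_le x) ih
    exact (le_mul_of_one_le_right' h).trans (leftMulResiduation_le_iff_mul_le.1 le_rfl)
  · simp only [presheafStr, le_iInf_iff, leftMulResiduation_le_iff_mul_le]
    intro xss hx
    rw [mul_comm]
    refine le_trans ?_ (φ.act xss xs)
    gcongr
    exact prod_zipWith_yoneda_le xs xss (by simpa using hx)

namespace Presheaf

/-- The limit of a weighted diagram of presheaves. -/
def lim {I : Type u} (w : I → V) (f : I → X.Presheaf) : X.Presheaf :=
  ⟨fun xs => ⨅ i, (w i ⇨ₗ (f i).1 xs),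
   (X.isPresheaf_iff _).2 fun zss ws => by
    refine le_iInf fun i => ?_
    rw [leftMulResiduation_le_iff_mul_le]
    refine le_trans ?_ ((f i).act zss ws)
    rw [mul_assoc]
    gcongr
    rw [← leftMulResiduation_le_iff_mul_le]
    exact iInf_le _ i⟩

theorem le_lim_iff {I : Type u} (w : I → V) (f : I → X.Presheaf) (v : V) (xs : List X.carrier) :
    v ≤ (lim w f).1 xs ↔ ∀ i, v * w i ≤ (f i).1 xs := by
  simp only [lim, le_iInf_iff, leftMulResiduation_le_iff_mul_le]

theorem le_rimp_iff (ψ χ : X.Presheaf) (v : V) (xs : List X.carrier) :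
    v ≤ (rimp ψ χ).1 xs ↔ ∀ ys, v * ψ.1 ys ≤ χ.1 (xs ++ ys) := by
  simp only [rimp, le_iInf_iff, leftMulResiduation_le_iff_mul_le]

theorem le_limp_iff (ψ χ : X.Presheaf) (v : V) (ys : List X.carrier) :
    v ≤ (limp ψ χ).1 ys ↔ ∀ xs, v * ψ.1 xs ≤ χ.1 (xs ++ ys) := by
  simp only [limp, le_iInf_iff, leftMulResiduation_le_iff_mul_le]

theorem rimp_yoneda (x : X.carrier) (φ : X.Presheaf) (xs : List X.carrier) :
    (rimp (X.yoneda x) φ).1 xs = φ.1 (xs ++ [x]) := by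
  refine eq_of_forall_le_iff fun v => ?_
  rw [le_rimp_iff]
  constructor
  · exact fun h => (le_mul_of_one_le_right' (X.one_le x)).trans (h [x])
  · intro h ys
    have := φ.act_right [ys] [x] xs
    simp only [listRel, mul_one, List.flatten_cons, List.flatten_nil, List.append_nil] at this
    refine le_trans ?_ this
    rw [mul_comm]
    exact mul_le_mul_right h _

theorem limp_yoneda (x : X.carrier) (φ : X.Presheaf) (xs : List X.carrier) :
    (limp (X.yoneda x) φ).1 xs = φ.1 (x :: xs) := by
  refine eq_of_forall_le_iff fun v => ?_
  rw [le_limp_iff]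
  constructor
  · exact fun h => (le_mul_of_one_le_right' (X.one_le x)).trans (h [x])
  · intro h ys
    have := φ.act_left [ys] [x] xs
    simp only [listRel, mul_one, List.flatten_cons, List.flatten_nil, List.append_nil] at this
    refine le_trans ?_ this
    rw [mul_comm]
    exact mul_le_mul_right h _

/-- The product `f₁ * ... * fₙ` of a list of presheaves. -/
noncomputable def prod (fs : List X.Presheaf) : X.Presheaf := X.presheafQuantale.prod fs

theorem prod_singleton (f : X.Presheaf) : prod [f] = f := mul_unit f

theorem prod_append (fs gs : List X.Presheaf) : prod (fs ++ gs) = mul (prod fs) (prod gs) := by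
  induction fs with
  | nil => exact (unit_mul _).symm
  | cons f fs ih =>
    change mul f (prod (fs ++ gs)) = mul (mul f (prod fs)) (prod gs)
    rw [ih, mul_assoc']

/-! ### The reflection -/

variable (X) in
/-- The representable presheaf of `x`, as an element of the algebra generated by the
representables. -/
noncomputable def genYoneda (x : X.carrier) : X.generatedAlg.carrier := X.toGeneratedAlg.toFun x

/-- The underlying presheaf of an element of the algebra generated by the representables. -/
def genVal (z : X.generatedAlg.carrier) : X.Presheaf := z.1

/-- The presheaves in the algebra generated by the representables are closed under translation:
iterated implications by representables insert lists on either side of the argument. -/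
theorem exists_translate (us vs : List X.carrier) (z : X.generatedAlg.carrier) :
    ∃ z' : X.generatedAlg.carrier, ∀ xs, (genVal z').1 xs = (genVal z).1 (us ++ xs ++ vs) := by
  induction us generalizing z with
  | nil =>
    induction vs generalizing z with
    | nil => exact ⟨z, fun xs => by simp⟩
    | cons v vs ih =>
      obtain ⟨z', hz'⟩ := ih z
      refine ⟨X.generatedAlg.rimp (genYoneda X v) z', fun xs => ?_⟩
      refine (rimp_yoneda v (genVal z') xs).trans ?_
      rw [hz']
      simp
  | cons u us ih =>
    obtain ⟨z', hz'⟩ := ih (X.generatedAlg.limp (genYoneda X u) z)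
    refine ⟨z', fun xs => ?_⟩
    rw [hz']
    exact limp_yoneda u (genVal z) _

/-- The reflection `⋀ z, [D_L(X)(φ, z), z]` of a presheaf into the weighted limits of elements `z`
of the algebra generated by the representables. -/
noncomputable def reflect (φ : X.Presheaf) : X.Presheaf :=
  lim (fun z : X.generatedAlg.carrier => X.presheafStr [φ] (genVal z)) genVal

theorem le_reflect (φ : X.Presheaf) (xs : List X.carrier) : φ.1 xs ≤ (reflect φ).1 xs := by
  rw [reflect, le_lim_iff]
  intro z
  rw [mul_comm]
  exact (le_str_singleton _ _ _).1 le_rfl xs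

end Presheaf

variable (X) in
/-- The weighted limits in `D_L(X)` of elements of the algebra generated by the representables. -/
def limitSet : Set X.presheafQuantale.carrier :=
  {φ | ∃ w : X.generatedAlg.carrier → V, φ = Presheaf.lim w Presheaf.genVal}

variable (X) in
/-- The injective hull of the algebra generated by the representables, as a subalgebra of
`D_L(X)`. -/
noncomputable def hullAlg : PQBAlg V := X.presheafQuantale.generatedPQBAlg X.limitSet

namespace Presheaf

/-- The elements of the hull do not distinguish a presheaf from its reflection, in any context
`(us; -; vs)`. -/
theorem reflect_le {χ : X.presheafQuantale.carrier}
    (hχ : VQuantale.Generated X.presheafQuantale X.limitSet χ)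
    (φ : X.Presheaf) (v : V) (us vs : List X.carrier)
    (h : ∀ xs, v * φ.1 xs ≤ χ.1 (us ++ xs ++ vs)) (xs : List X.carrier) :
    v * (reflect φ).1 xs ≤ χ.1 (us ++ xs ++ vs) := by
  induction hχ generalizing v us vs with
  | base χ hχ =>
    obtain ⟨w, rfl⟩ := hχ
    rw [le_lim_iff]
    intro z
    obtain ⟨z', hz'⟩ := exists_translate us vs z
    have h1 : v * w z ≤ X.presheafStr [φ] (genVal z') := by
      rw [le_str_singleton]
      intro ys
      rw [hz', mul_right_comm]
      exact (le_lim_iff _ _ _ _).1 (h ys) z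
    rw [← hz', mul_right_comm, mul_comm]
    exact (mul_le_mul_right h1 _).trans ((le_lim_iff _ _ _ _).1 le_rfl z')
  | rimp ψ χ _ _ _ ih =>
    refine (le_rimp_iff ψ χ _ _).2 fun ys => ?_
    rw [List.append_assoc, mul_right_comm]
    refine ih (v * ψ.1 ys) us (vs ++ ys) fun zs => ?_
    rw [mul_right_comm, ← List.append_assoc]
    exact (le_rimp_iff ψ χ _ _).1 (h zs) ys
  | limp ψ χ _ _ _ ih =>
    refine (le_limp_iff ψ χ _ _).2 fun ys => ?_
    rw [← List.append_assoc, ← List.append_assoc, mul_right_comm]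
    refine ih (v * ψ.1 ys) (ys ++ us) vs fun zs => ?_
    rw [mul_right_comm, List.append_assoc ys, List.append_assoc ys]
    exact (le_limp_iff ψ χ _ _).1 (h zs) ys

theorem str_le_str_reflect {χ : X.Presheaf}
    (hχ : VQuantale.Generated X.presheafQuantale X.limitSet χ) (φ : X.Presheaf) :
    X.presheafStr [φ] χ ≤ X.presheafStr [reflect φ] χ := by
  rw [le_str_singleton]
  intro xs
  simpa using reflect_le hχ φ _ [] [] (by simpa using (le_str_singleton _ φ χ).1 le_rfl) xs

theorem str_mul_le_str_mul_reflect {χ : X.Presheaf}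
    (hχ : VQuantale.Generated X.presheafQuantale X.limitSet χ) (φ ψ : X.Presheaf) :
    X.presheafStr [mul φ ψ] χ ≤ X.presheafStr [mul (reflect φ) (reflect ψ)] χ := by
  have h := (le_str_mul _ φ ψ χ).1 le_rfl
  rw [le_str_mul]
  intro xs ys
  rw [← mul_assoc]
  have := reflect_le hχ ψ (X.presheafStr [mul φ ψ] χ * (reflect φ).1 xs) xs [] (fun ys => ?_) ys
  · simpa using this
  · rw [mul_right_comm]
    have := reflect_le hχ φ (X.presheafStr [mul φ ψ] χ * ψ.1 ys) [] ys (fun xs => ?_) xs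
    · simpa using this
    · rw [mul_right_comm, mul_assoc]
      exact h xs ys

theorem str_le_str_of_le {φ ψ ψ' : X.Presheaf} (h : ∀ xs, ψ.1 xs ≤ ψ'.1 xs) :
    X.presheafStr [φ] ψ ≤ X.presheafStr [φ] ψ' := by
  rw [le_str_singleton]
  exact fun xs => ((le_str_singleton _ φ ψ).1 le_rfl xs).trans (h xs)

theorem generated_reflect (φ : X.Presheaf) :
    VQuantale.Generated X.presheafQuantale X.limitSet (reflect φ) :=
  .base _ ⟨_, rfl⟩

theorem reflect_eq_self (z : X.generatedAlg.carrier) : reflect (genVal z) = genVal z := by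
  refine Subtype.ext (funext fun xs => le_antisymm ?_ (le_reflect (genVal z) xs))
  exact (le_mul_of_one_le_right' (one_le_str (genVal z))).trans ((le_lim_iff _ _ _ _).1 le_rfl z)

end Presheaf

open Presheaf

variable (X) in
/-- The inclusion of the algebra generated by the representables into its hull. -/
noncomputable def toHullAlg : X.generatedAlg ⟶ X.hullAlg :=
  PQBAlg.Hom.mk (fun z => ⟨genVal z, by
      have := generated_reflect (genVal z)
      rwa [reflect_eq_self] at this⟩)
    (fun _ _ => le_rfl) (fun _ _ => one_le_str _) (fun _ _ => one_le_str _) (fun _ => le_rfl)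

/-- The underlying presheaf of an element of the hull. -/
def hullVal (χ : X.hullAlg.carrier) : X.Presheaf := χ.1

theorem hullAlg_multiStr (ψs : List X.hullAlg.carrier) (χ : X.hullAlg.carrier) :
    X.hullAlg.multiStr ψs χ = X.presheafStr (ψs.map hullVal) (hullVal χ) :=
  (X.presheafQuantale.generatedPQBAlg_multiStr _ ψs χ).trans (X.presheafStr_eq _ (hullVal χ)).symm

theorem hullAlg_multiStr_eq_prod (ψs : List X.hullAlg.carrier) (χ : X.hullAlg.carrier) :
    X.hullAlg.multiStr ψs χ = X.presheafStr [prod (ψs.map hullVal)] (hullVal χ) :=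
  X.presheafQuantale.generatedPQBAlg_multiStr _ ψs χ

theorem generatedAlg_multiStr (ψs : List X.generatedAlg.carrier) (χ : X.generatedAlg.carrier) :
    X.generatedAlg.multiStr ψs χ = X.presheafStr (ψs.map genVal) (genVal χ) :=
  (X.presheafQuantale.generatedPQBAlg_multiStr _ ψs χ).trans (X.presheafStr_eq _ (genVal χ)).symm

variable (X) in
/-- The representable presheaf of `x`, as an element of the hull. -/
noncomputable def hullYoneda (x : X.carrier) : X.hullAlg.carrier :=
  X.toHullAlg.toFun (genYoneda X x)

theorem multiStr_hullYoneda (xs : List X.carrier) (ψ : X.hullAlg.carrier) :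
    X.hullAlg.multiStr (xs.map X.hullYoneda) ψ = (hullVal ψ).1 xs := by
  rw [hullAlg_multiStr, List.map_map]
  exact presheafStr_map_yoneda xs (hullVal ψ)

theorem toHullAlg_fullyFaithful : PQBAlg.fullyFaithful V X.toHullAlg := by
  intro (ψs : List X.generatedAlg.carrier) (χ : X.generatedAlg.carrier)
  refine (generatedAlg_multiStr ψs χ).trans
    (Eq.trans ?_ (hullAlg_multiStr (ψs.map X.toHullAlg.toFun) (X.toHullAlg.toFun χ)).symm)
  rw [List.map_map]
  rfl

theorem toGeneratedAlg_fullyFaithful : LVCat.fullyFaithful V X.toGeneratedAlg := by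
  intro xs x
  refine Eq.trans ?_ (generatedAlg_multiStr (xs.map (genYoneda X)) (genYoneda X x)).symm
  rw [List.map_map]
  exact (presheafStr_map_yoneda xs (X.yoneda x)).symm

/-! ### Injectivity of the hull -/

/-- The value at `b` of the left Kan extension of `g : A ⟶ E` along `m : A ⟶ B`, computed in
`D_L(X)`: the colimit of the products `g a₁ * ... * g aₙ` weighted by `B(m as, b)`. -/
noncomputable def kanExt {A B : PQBAlg V} (m : A ⟶ B) (g : A ⟶ X.hullAlg) (b : B.carrier) :
    X.Presheaf :=
  colim (fun as : List A.carrier => B.multiStr (as.map m.toFun) b)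
    fun as => prod (as.map fun a => hullVal (g.toFun a))

section KanExt

variable {A B : PQBAlg V} (m : A ⟶ B) (g : A ⟶ X.hullAlg)

theorem le_kanExt (as : List A.carrier) (b : B.carrier) (xs : List X.carrier) :
    B.multiStr (as.map m.toFun) b *
      (prod (as.map fun a => hullVal (g.toFun a))).1 xs ≤ (kanExt m g b).1 xs :=
  le_iSup (fun as : List A.carrier => B.multiStr (as.map m.toFun) b *
      (prod (as.map fun a => hullVal (g.toFun a))).1 xs) as

theorem hom_le_str_kanExt (b b' : B.carrier) :
    B.hom b b' ≤ X.presheafStr [kanExt m g b] (kanExt m g b') := by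
  rw [le_str_singleton]
  intro xs
  refine mul_iSup_distrib.trans_le ?_
  refine iSup_le fun as => le_trans ?_ (le_kanExt m g as b' xs)
  rw [← mul_assoc, mul_comm (B.hom b b')]
  gcongr
  exact B.multiStr_hom _ _ _

theorem P_le_str_kanExt (b b' c : B.carrier) :
    B.P b b' c ≤ X.presheafStr [mul (kanExt m g b) (kanExt m g b')] (kanExt m g c) := by
  rw [le_str_mul]
  intro xs ys
  refine (congrArg (B.P b b' c * ·) iSup_mul_distrib).trans_le (mul_iSup_distrib.trans_le ?_)
  refine iSup_le fun as =>
    ((congrArg (B.P b b' c * ·) mul_iSup_distrib).trans mul_iSup_distrib).trans_le ?_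
  refine iSup_le fun as' => le_trans ?_ (le_kanExt m g (as ++ as') c (xs ++ ys))
  rw [List.map_append, List.map_append, prod_append, mul_mul_mul_comm, ← mul_assoc]
  refine mul_le_mul' ?_ (le_mul _ _ xs ys)
  rw [mul_comm, mul_assoc]
  exact B.multiStr_append _ _ _ _ _

theorem J_le_str_kanExt (b : B.carrier) :
    B.J b ≤ X.presheafStr [Presheaf.unit] (kanExt m g b) := by
  rw [le_str_singleton]
  exact fun xs => le_kanExt m g [] b xs

theorem str_kanExt_le {χ : X.hullAlg.carrier} (b : B.carrier) (v : V)
    (h : ∀ as : List A.carrier,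
      v * B.multiStr (as.map m.toFun) b ≤ X.hullAlg.multiStr (as.map g.toFun) χ) :
    v ≤ X.presheafStr [kanExt m g b] (hullVal χ) := by
  rw [kanExt, str_colim]
  refine le_iInf fun as => ?_
  rw [leftMulResiduation_le_iff_mul_le]
  refine (h as).trans (le_of_eq ?_)
  refine (hullAlg_multiStr_eq_prod (as.map g.toFun) χ).trans ?_
  rw [List.map_map]
  rfl

/-- The reflected Kan extension, as a morphism of prequantum B-algebras. -/
noncomputable def extend : B ⟶ X.hullAlg :=
  PQBAlg.Hom.mk (fun b => ⟨reflect (kanExt m g b), generated_reflect _⟩)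
    (fun b b' => (hom_le_str_kanExt m g b b').trans <|
      (str_le_str_of_le (le_reflect _)).trans (str_le_str_reflect (generated_reflect _) _))
    (fun x y => by
      change 1 ≤ X.presheafStr [reflect (kanExt m g (B.rimp x y))]
        (rimp (reflect (kanExt m g x)) (reflect (kanExt m g y)))
      rw [← str_mul_rimp]
      refine le_trans ?_ ((P_le_str_kanExt m g (B.rimp x y) x y).trans <|
        (str_le_str_of_le (le_reflect _)).trans
          (str_mul_le_str_mul_reflect (generated_reflect _) _ _))
      rw [B.P_rimp]
      exact B.one_le _)
    (fun x y => by
      change 1 ≤ X.presheafStr [reflect (kanExt m g (B.limp x y))]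
        (limp (reflect (kanExt m g x)) (reflect (kanExt m g y)))
      rw [← str_mul_limp]
      refine le_trans ?_ ((P_le_str_kanExt m g x (B.limp x y) y).trans <|
        (str_le_str_of_le (le_reflect _)).trans
          (str_mul_le_str_mul_reflect (generated_reflect _) _ _))
      rw [B.P_limp]
      exact B.one_le _)
    (fun b => (J_le_str_kanExt m g b).trans (str_le_str_of_le (le_reflect _)))

theorem comp_extend (hm : PQBAlg.fullyFaithful V m) : m ≫ extend m g = g := by
  refine PQBAlg.Hom.ext (funext fun a => Subtype.ext ?_)
  change reflect (kanExt m g (m.toFun a)) = hullVal (g.toFun a)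
  refine str_separated _ _ ?_ ?_
  · refine le_trans ?_ (str_le_str_reflect (g.toFun a).2 _)
    refine str_kanExt_le m g _ _ fun as => ?_
    rw [one_mul]
    exact (hm as a).ge.trans (PQBAlg.Hom.isFunctor g as a)
  · refine le_trans ?_ (str_le_str_of_le (le_reflect _))
    rw [le_str_singleton]
    intro xs
    refine le_trans ?_ (le_kanExt m g [a] (m.toFun a) xs)
    rw [List.map_singleton, List.map_singleton, prod_singleton]
    gcongr
    exact B.one_le _

end KanExt

theorem hullAlg_isInjective : IsInjective (PQBAlg.fullyFaithful V) X.hullAlg :=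
  fun _ _ m g hm => ⟨extend m g, comp_extend m g hm⟩

/-! ### Essentiality of the hull -/

theorem str_append_le (Z : LVCat V) (xss : List Z.carrier) (c x y : Z.carrier) :
    Z.str xss c * Z.str [c, x] y ≤ Z.str (xss ++ [x]) y := by
  have h := Z.comp_le [xss, [x]] [c, x] y
  simp only [listRel, mul_one, List.flatten_cons, List.flatten_nil, List.append_nil] at h
  refine le_trans ?_ h
  gcongr
  exact le_mul_of_one_le_right' (Z.one_le x)

theorem str_cons_le (Z : LVCat V) (xss : List Z.carrier) (c x y : Z.carrier) :
    Z.str xss c * Z.str [x, c] y ≤ Z.str (x :: xss) y := by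
  have h := Z.comp_le [[x], xss] [x, c] y
  simp only [listRel, mul_one, List.flatten_cons, List.flatten_nil, List.append_nil] at h
  refine le_trans ?_ h
  gcongr
  exact le_mul_of_one_le_left' (Z.one_le x)

theorem hullAlg_multiStr_rimp (ψs : List X.hullAlg.carrier) (x y : X.hullAlg.carrier) :
    X.hullAlg.multiStr ψs (X.hullAlg.rimp x y) = X.hullAlg.multiStr (ψs ++ [x]) y := by
  rw [hullAlg_multiStr_eq_prod, hullAlg_multiStr_eq_prod, List.map_append, prod_append,
    List.map_singleton, prod_singleton]
  exact (str_mul_rimp _ _ _).symm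

theorem hullAlg_multiStr_limp (ψs : List X.hullAlg.carrier) (x y : X.hullAlg.carrier) :
    X.hullAlg.multiStr ψs (X.hullAlg.limp x y) = X.hullAlg.multiStr (x :: ψs) y := by
  rw [hullAlg_multiStr_eq_prod, hullAlg_multiStr_eq_prod]
  exact (str_mul_limp _ _ _).symm

theorem le_multiStr_hullAlg_lim (ψs : List X.hullAlg.carrier) {χ : X.hullAlg.carrier}
    {w : X.generatedAlg.carrier → V} (h : hullVal χ = lim w genVal) (v : V) :
    v ≤ X.hullAlg.multiStr ψs χ ↔
      ∀ z, v * w z ≤ X.hullAlg.multiStr ψs (X.toHullAlg.toFun z) := by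
  have h1 : ∀ z, hullVal (X.toHullAlg.toFun z) = genVal z := fun _ => rfl
  simp only [hullAlg_multiStr, presheafStr, le_iInf_iff, leftMulResiduation_le_iff_mul_le, h, h1,
    le_lim_iff, mul_right_comm v]
  exact ⟨fun h z xss hx => h xss hx z, fun h xss hx z => h z xss hx⟩

section Essential

variable {Z : LVCat V} {f : X.hullAlg.carrier → Z.carrier}

theorem prod_zipWith_le_listRel (hf : IsFunctor X.hullAlg.multiStr Z.str f)
    (ψs : List X.hullAlg.carrier) (xss : List (List X.carrier)) (h : xss.length = ψs.length) :
    (List.zipWith (fun (φ : X.Presheaf) xs => φ.1 xs) (ψs.map hullVal) xss).prod ≤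
      listRel Z.str (xss.map (List.map fun x => f (X.hullYoneda x))) (ψs.map f) := by
  induction ψs generalizing xss with
  | nil =>
    match xss, h with
    | [], _ => simp [listRel]
  | cons ψ ψs ih =>
    match xss, h with
    | xs :: xss, h =>
      simp only [List.map_cons, List.zipWith_cons_cons, List.prod_cons, listRel]
      refine mul_le_mul' ?_ (ih xss (by simpa using h))
      have h1 := hf (xs.map X.hullYoneda) ψ
      rwa [multiStr_hullYoneda, List.map_map] at h1

theorem str_map_hullYoneda_le (hf : IsFunctor X.hullAlg.multiStr Z.str f)
    (hX : ∀ xs x, Z.str (xs.map fun x => f (X.hullYoneda x)) (f (X.hullYoneda x)) ≤ X.str xs x)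
    (ψs : List X.hullAlg.carrier) (x : X.carrier) :
    Z.str (ψs.map f) (f (X.hullYoneda x)) ≤ X.hullAlg.multiStr ψs (X.hullYoneda x) := by
  rw [hullAlg_multiStr]
  simp only [presheafStr, le_iInf_iff, leftMulResiduation_le_iff_mul_le]
  intro xss hx
  rw [mul_comm]
  refine (mul_le_mul_left (prod_zipWith_le_listRel hf ψs xss (by simpa using hx)) _).trans ?_
  refine (Z.comp_le _ _ _).trans ?_
  rw [← List.map_flatten]
  exact hX xss.flatten x

/-- The inequality `Z(f ψs, f χ) ≤ E(ψs, χ)` passes from `χ = y` to `χ = x ▷ y`. -/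
theorem str_map_rimp_le (hf : IsFunctor X.hullAlg.multiStr Z.str f) (x y : X.hullAlg.carrier)
    (h : ∀ ψs : List X.hullAlg.carrier, Z.str (ψs.map f) (f y) ≤ X.hullAlg.multiStr ψs y)
    (ψs : List X.hullAlg.carrier) :
    Z.str (ψs.map f) (f (X.hullAlg.rimp x y)) ≤ X.hullAlg.multiStr ψs (X.hullAlg.rimp x y) := by
  rw [hullAlg_multiStr_rimp]
  refine le_trans ?_ (h _)
  rw [List.map_append]
  refine le_trans ?_ (str_append_le Z _ (f (X.hullAlg.rimp x y)) (f x) _)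
  exact le_mul_of_one_le_right'
    ((X.hullAlg.one_le_multiStr_rimp x y).trans (hf [X.hullAlg.rimp x y, x] y))

/-- The inequality `Z(f ψs, f χ) ≤ E(ψs, χ)` passes from `χ = y` to `χ = x ◁ y`. -/
theorem str_map_limp_le (hf : IsFunctor X.hullAlg.multiStr Z.str f) (x y : X.hullAlg.carrier)
    (h : ∀ ψs : List X.hullAlg.carrier, Z.str (ψs.map f) (f y) ≤ X.hullAlg.multiStr ψs y)
    (ψs : List X.hullAlg.carrier) :
    Z.str (ψs.map f) (f (X.hullAlg.limp x y)) ≤ X.hullAlg.multiStr ψs (X.hullAlg.limp x y) := by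
  rw [hullAlg_multiStr_limp]
  refine le_trans ?_ (h _)
  refine le_trans ?_ (str_cons_le Z _ (f (X.hullAlg.limp x y)) (f x) _)
  exact le_mul_of_one_le_right'
    ((X.hullAlg.one_le_multiStr_limp x y).trans (hf [x, X.hullAlg.limp x y] y))

theorem str_map_toHullAlg_le (hf : IsFunctor X.hullAlg.multiStr Z.str f)
    (hX : ∀ xs x, Z.str (xs.map fun x => f (X.hullYoneda x)) (f (X.hullYoneda x)) ≤ X.str xs x)
    (z : X.generatedAlg.carrier) (ψs : List X.hullAlg.carrier) :
    Z.str (ψs.map f) (f (X.toHullAlg.toFun z)) ≤ X.hullAlg.multiStr ψs (X.toHullAlg.toFun z) := by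
  obtain ⟨z, hz⟩ := z
  induction hz generalizing ψs with
  | base z hz =>
    obtain ⟨x, rfl⟩ := hz
    exact str_map_hullYoneda_le hf hX ψs x
  | rimp x y hx hy _ ih =>
    exact str_map_rimp_le hf (X.toHullAlg.toFun ⟨x, hx⟩) (X.toHullAlg.toFun ⟨y, hy⟩) ih ψs
  | limp x y hx hy _ ih =>
    exact str_map_limp_le hf (X.toHullAlg.toFun ⟨x, hx⟩) (X.toHullAlg.toFun ⟨y, hy⟩) ih ψs

/-- The inequality `Z(f ψs, f χ) ≤ E(ψs, χ)` passes from the elements of the algebra generated by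
the representables to their weighted limits. -/
theorem str_map_lim_le (hf : IsFunctor X.hullAlg.multiStr Z.str f)
    (h : ∀ z (ψs : List X.hullAlg.carrier),
      Z.str (ψs.map f) (f (X.toHullAlg.toFun z)) ≤ X.hullAlg.multiStr ψs (X.toHullAlg.toFun z))
    {χ : X.hullAlg.carrier} {w : X.generatedAlg.carrier → V} (hχ : hullVal χ = lim w genVal)
    (ψs : List X.hullAlg.carrier) :
    Z.str (ψs.map f) (f χ) ≤ X.hullAlg.multiStr ψs χ := by
  refine (le_multiStr_hullAlg_lim ψs hχ _).2 fun z => le_trans ?_ (h z ψs)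
  have h1 : w z ≤ X.hullAlg.multiStr [χ] (X.toHullAlg.toFun z) := by
    simpa using (le_multiStr_hullAlg_lim [χ] hχ 1).1 (X.hullAlg.one_le χ) z
  refine (mul_le_mul_right (h1.trans (hf [χ] (X.toHullAlg.toFun z))) _).trans ?_
  rw [List.map_singleton]
  have h2 := Z.comp_le [ψs.map f] [f χ] (f (X.toHullAlg.toFun z))
  simpa only [listRel, mul_one, List.flatten_cons, List.flatten_nil, List.append_nil] using h2

/-- An `(L,V)`-functor on the hull reflects the structure if it does so on `X`.  The induction is
on the last argument `χ` only: the list `ψs` stays arbitrary, since implications enlarge it. -/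
theorem str_map_le (hf : IsFunctor X.hullAlg.multiStr Z.str f)
    (hX : ∀ xs x, Z.str (xs.map fun x => f (X.hullYoneda x)) (f (X.hullYoneda x)) ≤ X.str xs x)
    (χ : X.hullAlg.carrier) (ψs : List X.hullAlg.carrier) :
    Z.str (ψs.map f) (f χ) ≤ X.hullAlg.multiStr ψs χ := by
  obtain ⟨χ, hχ⟩ := χ
  induction hχ generalizing ψs with
  | base χ hχ =>
    obtain ⟨w, hw⟩ := hχ
    exact str_map_lim_le hf (str_map_toHullAlg_le hf hX) (χ := ⟨χ, .base χ ⟨w, hw⟩⟩) hw ψs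
  | rimp x y hx hy _ ih => exact str_map_rimp_le hf ⟨x, hx⟩ ⟨y, hy⟩ ih ψs
  | limp x y hx hy _ ih => exact str_map_limp_le hf ⟨x, hx⟩ ⟨y, hy⟩ ih ψs

end Essential

variable (X) in
/-- The Yoneda embedding, corestricted to the hull. -/
noncomputable def toHull : X ⟶ (PQBAlg.toMulti V).obj X.hullAlg :=
  X.toGeneratedAlg ≫ (PQBAlg.toMulti V).map X.toHullAlg

theorem toHull_isEssential : IsEssential (LVCat.fullyFaithful V) X.toHull :=
  ⟨LVCat.fullyFaithful_comp _ _ toGeneratedAlg_fullyFaithful toHullAlg_fullyFaithful,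
    fun _ f hf ψs χ => le_antisymm (f.isFunctor ψs χ)
      (str_map_le f.isFunctor (fun xs x => (hf xs x).ge) χ ψs)⟩

/-- Essentiality among prequantum B-algebras follows from essentiality of `X → E` in `V`-`Multi`,
since `X → Y` is fully faithful. -/
theorem toHullAlg_isInjectiveHull :
    IsInjectiveHull (PQBAlg.fullyFaithful V) X.toHullAlg := by
  refine ⟨hullAlg_isInjective, toHullAlg_fullyFaithful, fun Z f hf => ?_⟩
  exact toHull_isEssential.2 ((PQBAlg.toMulti V).map f)
    (LVCat.fullyFaithful_comp X.toGeneratedAlg _ toGeneratedAlg_fullyFaithful hf)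

end LVCat

end QMulti

theorem mainTheorem9 {V : Type u} [CommMonoid V] [CompleteLattice V] [IsQuantale V]
    (X : QMulti.LVCat V) :
    (∃ (E : QMulti.PQBAlg V) (e : X.generatedAlg ⟶ E),
      QMulti.IsInjectiveHull (QMulti.PQBAlg.fullyFaithful V) e) ∧
    ∀ (E : QMulti.PQBAlg V) (e : X.generatedAlg ⟶ E),
      QMulti.IsInjectiveHull (QMulti.PQBAlg.fullyFaithful V) e →
      QMulti.IsEssential (QMulti.LVCat.fullyFaithful V)
        (X.toGeneratedAlg ≫ (QMulti.PQBAlg.toMulti V).map e) := by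
  refine ⟨⟨_, X.toHullAlg, QMulti.LVCat.toHullAlg_isInjectiveHull⟩, fun E e he => ?_⟩
  obtain ⟨hE, heJ, hess⟩ := he
  refine ⟨QMulti.LVCat.fullyFaithful_comp _ _ QMulti.LVCat.toGeneratedAlg_fullyFaithful heJ,
    fun Z f hf => ?_⟩
  -- `s` embeds `E` into the concrete hull, and `r` is a retraction of `s`.
  obtain ⟨s, hs⟩ := QMulti.LVCat.hullAlg_isInjective e X.toHullAlg heJ
  have hsJ : QMulti.PQBAlg.fullyFaithful V s :=
    hess s (by rw [hs]; exact QMulti.LVCat.toHullAlg_fullyFaithful)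
  obtain ⟨r, hr⟩ := hE s (𝟙 E) hsJ
  have her : X.toHullAlg ≫ r = e := by rw [← hs, Category.assoc, hr, Category.comp_id]
  have hrf := QMulti.LVCat.toHull_isEssential.2 ((QMulti.PQBAlg.toMulti V).map r ≫ f) (by
    have h : X.toHull ≫ (QMulti.PQBAlg.toMulti V).map r ≫ f =
        (X.toGeneratedAlg ≫ (QMulti.PQBAlg.toMulti V).map e) ≫ f := by
      rw [← her, CategoryTheory.Functor.map_comp, QMulti.LVCat.toHull, Category.assoc,
        Category.assoc, Category.assoc]
    rw [h]
    exact hf)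
  have hsrf : (QMulti.PQBAlg.toMulti V).map s ≫ (QMulti.PQBAlg.toMulti V).map r ≫ f = f := by
    rw [← Category.assoc, ← CategoryTheory.Functor.map_comp, hr,
      CategoryTheory.Functor.map_id, Category.id_comp]
  rw [← hsrf]
  exact QMulti.LVCat.fullyFaithful_comp _ _ hsJ hrf
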